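/- Consider a chain of $n$ sites $\{1,\dots,n\}$, each with Hilbert space $\mathbb{C}^d$ ($d\ge 1$), and let $k\ge 1$. Let $H=\sum_{j=1}^n h_j$, where each $h_j$ is self-adjoint, acts only on the sites of $\{j,j+1,\dots,j+k-1\}\cap\{1,\dots,n\}$, and satisfies $\|h_j\|\le 1$ in operator norm. Let $L\subset\{1,\dots,n\}$ be a set of consecutive sites with $|L|\le k$, and let $O_L$ be an operator supported on $L$. For $\tau\ge 0$ put $O_L(i\tau)=e^{\tau H}O_Le^{-\tau H}$. For an integer $l$ let $L_l$ be the set of all sites of the chain at distance at most $l$ from $L$, with complement $L_l^{\mathrm c}$, and for an operator $O$ on the chain let $$O^{(L_l)}=\frac{1}{\mathrm{tr}_{L_l^{\mathrm c}}(\hat 1_{L_l^{\mathrm c}})}\,\mathrm{tr}_{L_l^{\mathrm c}}(O)\otimes \hat 1_{L_l^{\mathrm c}}$$ be its normalized partial-trace truncation to $L_l$. Let $\gamma\simeq 1.6026$ (any real number with $|\gamma-1.6026|\le 10^{-4}$) and, for $l>k$ (so that $\log\lceil l/k\rceil>0$), put $$\zeta_l=\frac{6ek\tau}{\gamma\log\lceil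 l/k\rceil}.$$ If $\zeta_l<1$, then $$\bigl\|O_L(i\tau)-[O_L(i\tau)]^{(L_l)}\bigr\|\le \|O_L\|\,\frac{\zeta_l^{\lceil l/k\rceil}}{1-\zeta_l}.$$ -/

import Mathlib

open scoped Matrix.Norms.L2Operator Kronecker

namespace SpinChain

/-- Configurations of a set of sites, each carrying `d` levels; they label the product basis of
the Hilbert space of these sites. -/
abbrev Config (ι : Type) (d : ℕ) : Type := ι → Fin d

/-- Linear operators on the Hilbert space of the sites `ι` (one copy of `ℂ ^ d` per site), as
matrices in the product basis. The norm `‖·‖` is the operator norm for the Euclidean norm. -/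
abbrev Operator (ι : Type) (d : ℕ) : Type := Matrix (Config ι d) (Config ι d) ℂ

variable {n d : ℕ}

/-- The splitting of a configuration of the whole chain into its parts on `S` and on the
complement of `S`. -/
def split (d : ℕ) (S : Finset (Fin n)) :
    Config (Fin n) d ≃ Config {i // i ∈ S} d × Config {i // i ∉ S} d :=
  Equiv.piEquivPiSubtypeProd (fun i => i ∈ S) (fun _ => Fin d)

/-- `tensorOne S B` is the operator `B ⊗ 1` on the whole chain, where `B` acts on the sites of
`S` and `1` is the identity on the complement of `S`. -/
def tensorOne (S : Finset (Fin n)) (B : Operator {i // i ∈ S} d) : Operator (Fin n) d :=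
  Matrix.reindex (split d S).symm (split d S).symm
    (B ⊗ₖ (1 : Operator {i // i ∉ S} d))

/-- `A` is supported on (acts only on) the sites of `S`. -/
def SupportedOn (S : Finset (Fin n)) (A : Operator (Fin n) d) : Prop :=
  ∃ B : Operator {i // i ∈ S} d, A = tensorOne S B

/-- The partial trace over the complement of `S`. -/
def partialTraceCompl (S : Finset (Fin n)) (A : Operator (Fin n) d) :
    Operator {i // i ∈ S} d :=
  Matrix.of fun a b =>
    ∑ c : Config {i // i ∉ S} d, A ((split d S).symm (a, c)) ((split d S).symm (b, c))

/-- The truncation of `A` to the region `S`: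
`(tr_{Sᶜ} 1)⁻¹ • (tr_{Sᶜ} A) ⊗ 1`. -/
noncomputable def truncation (S : Finset (Fin n)) (A : Operator (Fin n) d) :
    Operator (Fin n) d :=
  (Matrix.trace (1 : Operator {i // i ∉ S} d))⁻¹ • tensorOne S (partialTraceCompl S A)

/-- The local terms `h j` of a one-dimensional Hamiltonian of interaction length `k`: each is
self-adjoint, has operator norm at most one, and acts only on the sites `j, j + 1, …, j + k - 1`
(those of them that belong to the chain). -/
structure IsLocalHamiltonian (k : ℕ) (h : Fin n → Operator (Fin n) d) : Prop where
  isHermitian : ∀ j, (h j).IsHermitian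
  norm_le_one : ∀ j, ‖h j‖ ≤ 1
  supportedOn : ∀ j : Fin n,
    SupportedOn (Finset.univ.filter fun i : Fin n => j.val ≤ i.val ∧ i.val < j.val + k) (h j)

/-- The region `L` enlarged by `l` sites at both ends: the sites of the chain at distance at
most `l` from some site of `L`. -/
def enlarge (L : Finset (Fin n)) (l : ℕ) : Finset (Fin n) :=
  Finset.univ.filter fun i : Fin n => ∃ j ∈ L, Nat.dist i.val j.val ≤ l

/-- The imaginary-time evolution `e^{τ H} A e^{-τ H}`. -/
noncomputable def imaginaryEvolution (H : Operator (Fin n) d) (τ : ℝ) (A : Operator (Fin n) d) :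
    Operator (Fin n) d :=
  NormedSpace.exp ((τ : ℂ) • H) * A * NormedSpace.exp (-((τ : ℂ) • H))

/-- `ζ_l = 6 e k τ / (γ log ⌈l / k⌉)`. -/
noncomputable def zeta (γ : ℝ) (k l : ℕ) (τ : ℝ) : ℝ :=
  6 * Real.exp 1 * k * τ / (γ * Real.log ⌈(l : ℝ) / k⌉₊)

end SpinChain

namespace SpinChain

variable {n d : ℕ}

/-! Expand `e^{τH} O e^{-τH}` in nested commutators with `H`. The `s`-th term lives within distance
`s(k-1)` of `L`, so truncation fixes all terms with `s < m = ⌈l/k⌉`, and only the tail contributes;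
there `id - truncation` costs a factor 2.

To bound the tail, enclose the support in an interval of length `k + r(k-1)`. A local term inside it
leaves it unchanged (at most `k(r+1)` choices); one crossing an end enlarges it by `k-1` (at most
`k` choices per end). Each commutator costs a factor 2, so the norm is at most `(2k)^s * growthCount
s 0 * ‖O‖`.

By `hasSum_growthCount`, `growthCount s 0` is the `s`-th moment of `Q + 1` for `Q` Poisson of mean
2, and an exponential moment bound gives `2 * growthCount s 0 / s! ≤ (3e / (γ log s))^s`. Since `log
m ≤ log s`, a geometric series remains. -/

/-! ### Combinatorics of growing intervals -/

/-- Weighted count of the growth histories with `s` steps of an interval that has already been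
enlarged `r` times: a step either keeps the interval or enlarges it at one of its two ends. -/
def growthCount : ℕ → ℕ → ℕ
  | 0, _ => 1
  | s + 1, r => (r + 1) * growthCount s r + 2 * growthCount s (r + 1)

/-- A Dobiński-type formula for `growthCount`. -/
theorem hasSum_growthCount (s r : ℕ) :
    HasSum (fun q : ℕ => (2 : ℝ) ^ q / q.factorial * ((q : ℝ) + r + 1) ^ s)
      (Real.exp 2 * growthCount s r) := by
  induction s generalizing r with
  | zero =>
    have := NormedSpace.expSeries_div_hasSum_exp (2 : ℝ)
    rw [← Real.exp_eq_exp_ℝ] at this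
    simpa [growthCount] using this
  | succ s ih =>
    have h1 := (ih r).mul_left ((r : ℝ) + 1)
    have h2 : HasSum (fun q : ℕ => (q : ℝ) * ((2 : ℝ) ^ q / q.factorial) * ((q : ℝ) + r + 1) ^ s)
        (2 * (Real.exp 2 * growthCount s (r + 1))) := by
      -- The `q = 0` term vanishes; after the shift, `q / q!` cancels and `r` becomes `r + 1`.
      rw [← hasSum_nat_add_iff' 1]
      simp only [Finset.range_one, Finset.sum_singleton, Nat.cast_zero, zero_mul, sub_zero]
      refine ((ih (r + 1)).mul_left 2).congr_fun fun q => ?_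
      rw [Nat.factorial_succ, pow_succ]
      push_cast
      field_simp
      ring
    have h4 := h1.add h2
    rw [show (r + 1 : ℝ) * (Real.exp 2 * growthCount s r) +
        2 * (Real.exp 2 * growthCount s (r + 1)) = Real.exp 2 * growthCount (s + 1) r by
      simp only [growthCount]; push_cast; ring] at h4
    exact h4.congr_fun fun q => by ring

/-- Chernoff-type bound: insert `(q+1)^s ≤ s! e^{t(q+1)} / t^s` into the Dobiński series and sum the
resulting exponential series. -/
theorem growthCount_le {t : ℝ} (ht : 0 < t) (s : ℕ) :
    (growthCount s 0 : ℝ) / s.factorial ≤ Real.exp (t + 2 * Real.exp t - 2) / t ^ s := by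
  have h1 := hasSum_growthCount s 0
  have h2 := NormedSpace.expSeries_div_hasSum_exp (2 * Real.exp t : ℝ)
  rw [← Real.exp_eq_exp_ℝ] at h2
  have h3 := h2.mul_left (s.factorial / t ^ s * Real.exp t)
  have h4 := hasSum_le (fun q => ?_) h1 h3
  · rw [show t + 2 * Real.exp t - 2 = -2 + (t + 2 * Real.exp t) by ring, Real.exp_add, Real.exp_add,
      Real.exp_neg]
    have := Real.exp_pos 2
    have := s.factorial_pos
    rw [div_le_div_iff₀ (by positivity) (by positivity)]
    field_simp at h4 ⊢
    linarith
  · have h5 := Real.pow_div_factorial_le_exp (t * (q + 1)) (by positivity) s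
    have h6 : Real.exp (t * (q + 1)) = Real.exp t * Real.exp t ^ q := by
      rw [← Real.exp_nat_mul, ← Real.exp_add]; ring_nf
    rw [h6, mul_pow] at h5
    have h7 : ((q : ℝ) + 1) ^ s ≤ s.factorial / t ^ s * (Real.exp t * Real.exp t ^ q) := by
      have : (0 : ℝ) < s.factorial := by exact_mod_cast s.factorial_pos
      rw [div_le_iff₀ this] at h5
      rw [div_mul_eq_mul_div, le_div_iff₀ (by positivity)]
      linarith
    calc _ ≤ (2 : ℝ) ^ q / q.factorial * (s.factorial / t ^ s * (Real.exp t * Real.exp t ^ q)) := by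
          simp only [Nat.cast_zero, add_zero]
          gcongr
      _ = _ := by rw [mul_pow]; ring

/-- Take `t = (log s) / 2` in `growthCount_le`, so that `e^t = √s` and the numerator grows slower
than any `c^s` with `c > 1`. The factor 2 is reserved for the norm of `id - truncation`. -/
theorem two_mul_growthCount_div_factorial_le {γ : ℝ} (hγ₀ : 0 < γ) (hγ : γ ≤ 1.6027) {s : ℕ}
    (hs : 2 ≤ s) :
    2 * ((growthCount s 0 : ℝ) / s.factorial) ≤
      (3 * Real.exp 1 / (γ * Real.log s)) ^ s := by
  have hlog : 0 < Real.log s := Real.log_pos (by exact_mod_cast hs)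
  -- The general estimate narrowly fails at `s = 2`, where the left side is 11.
  obtain rfl | hs3 := hs.eq_or_lt
  · have h1 : (4 : ℝ) ≤ 3 * Real.exp 1 / (γ * Real.log (2 : ℕ)) := by
      have := Real.log_two_lt_d9
      have h3 := Real.exp_one_gt_d9
      rw [le_div_iff₀ (by positivity)]
      push_cast at hlog ⊢
      have : γ * Real.log 2 ≤ 1.6027 * 0.6931471808 := by gcongr
      linarith
    calc _ ≤ (4 : ℝ) ^ 2 := by norm_num [growthCount, Nat.factorial]
      _ ≤ _ := by gcongr
  · set x := Real.sqrt s with hx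
    have hxs : x ^ 2 = s := Real.sq_sqrt (by positivity)
    have hx3 : 1.73 ≤ x := by
      apply Real.le_sqrt_of_sq_le
      have : (3 : ℝ) ≤ s := by exact_mod_cast hs3
      norm_num
      linarith
    have hx0 : 0 < x := by linarith
    have hlx : Real.log s = 2 * Real.log x := by rw [← hxs, Real.log_pow]; norm_num
    have hlx0 : 0 < Real.log x := by linarith
    refine (mul_le_mul_of_nonneg_left (growthCount_le hlx0 s) zero_le_two).trans ?_
    rw [Real.exp_log hx0, ← mul_div_assoc, div_le_iff₀ (by positivity), ← mul_pow]
    have e1 : 3 * Real.exp 1 / (γ * Real.log s) * Real.log x = 3 / 2 / γ * Real.exp 1 := by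
      rw [hlx]; field_simp
    rw [e1]
    -- `3 / (2γ)` is at least about 0.9359, just above `e^{-0.07} ≈ 0.9324`.
    have e2 : Real.exp 0.93 ≤ 3 / 2 / γ * Real.exp 1 := by
      have h2 : Real.exp (-0.07) ≤ 0.9325 := by
        rw [Real.exp_neg, inv_le_comm₀ (Real.exp_pos _) (by norm_num)]
        have := Real.quadratic_le_exp_of_nonneg (x := 0.07) (by norm_num)
        norm_num at this ⊢
        linarith
      have h3 : Real.exp 0.93 = Real.exp (-0.07) * Real.exp 1 := by
        rw [← Real.exp_add]; norm_num
      rw [h3]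
      gcongr
      refine h2.trans ?_
      rw [le_div_iff₀ hγ₀]
      linarith
    calc 2 * Real.exp (Real.log x + 2 * x - 2)
        = Real.exp (Real.log 2 + (Real.log x + 2 * x - 2)) := by
          rw [Real.exp_add, Real.exp_log two_pos]
      _ ≤ Real.exp (s * 0.93) := by
          apply Real.exp_le_exp.2
          -- The tangent of `log` at 2 reduces the claim to a quadratic inequality valid for `x ≥
          -- 1.73`.
          have h1 := Real.log_le_sub_one_of_pos (x := x / 2) (by positivity)
          rw [Real.log_div hx0.ne' two_ne_zero] at h1
          have := Real.log_two_lt_d9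
          rw [← hxs]
          nlinarith
      _ = Real.exp 0.93 ^ s := by rw [← Real.exp_nat_mul]
      _ ≤ _ := by gcongr

/-! ### Truncation as a norm contraction -/

theorem tensorOne_apply (S : Finset (Fin n)) (B : Operator {i // i ∈ S} d)
    (x y : Config (Fin n) d) :
    tensorOne S B x y =
      if ∀ i ∉ S, x i = y i then B (fun i => x i) (fun i => y i) else 0 := by
  have h1 : (split d S x).2 = (split d S y).2 ↔ ∀ i ∉ S, x i = y i := by
    simp [split, Equiv.piEquivPiSubtypeProd, funext_iff]
  change B _ _ * (1 : Operator {i // i ∉ S} d) (split d S x).2 (split d S y).2 = _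
  rw [Matrix.one_apply]
  simp only [h1]
  split_ifs
  · rw [mul_one]; rfl
  · rw [mul_zero]

/-- `tensorOne S` as a homomorphism of star algebras. -/
def tensorOneHom (S : Finset (Fin n)) :
    Operator {i // i ∈ S} d →⋆ₙₐ[ℂ] Operator (Fin n) d where
  toFun := tensorOne S
  map_smul' c B := by ext x y; simp [tensorOne, mul_assoc]
  map_zero' := by ext x y; simp [tensorOne]
  map_add' B C := by ext x y; simp [tensorOne, add_mul]
  map_mul' B C := by
    have h : (B * C) ⊗ₖ (1 : Operator {i // i ∉ S} d) = B ⊗ₖ 1 * C ⊗ₖ 1 := by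
      rw [← Matrix.mul_kronecker_mul, one_mul]
    simp only [tensorOne, Matrix.reindex_apply]
    rw [h, Matrix.submatrix_mul_equiv]
  map_star' B := by
    simp only [tensorOne, Matrix.star_eq_conjTranspose, Matrix.conjTranspose_reindex,
      Matrix.conjTranspose_kronecker, Matrix.conjTranspose_one]

theorem norm_tensorOne_le (S : Finset (Fin n)) (B : Operator {i // i ∈ S} d) :
    ‖tensorOne S B‖ ≤ ‖B‖ :=
  NonUnitalStarAlgHom.norm_apply_le (tensorOneHom S) B

theorem norm_one_matrix_le {m : Type*} [Fintype m] [DecidableEq m] :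
    ‖(1 : Matrix m m ℂ)‖ ≤ 1 := by
  rw [← Matrix.diagonal_one, Matrix.l2_opNorm_diagonal]
  exact (pi_norm_le_iff_of_nonneg zero_le_one).2 fun _ => by simp

/-- The submatrix is the compression `V* A V` by an isometry `V`. The partial trace is a sum of such
compressions. -/
theorem norm_submatrix_le {l m : Type*} [Fintype l] [DecidableEq l] [Fintype m] [DecidableEq m]
    (A : Matrix m m ℂ) {f : l → m} (hf : Function.Injective f) :
    ‖A.submatrix f f‖ ≤ ‖A‖ := by
  set V : Matrix m l ℂ := (1 : Matrix m m ℂ).submatrix id f with hV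
  have h1 : V.conjTranspose * V = 1 := by
    ext a b
    simp [hV, Matrix.mul_apply, Matrix.one_apply, hf.eq_iff, eq_comm]
  have h2 : V.conjTranspose * A * V = A.submatrix f f := by
    ext a b
    simp [hV, Matrix.mul_apply, Matrix.one_apply]
  have h3 : ‖V‖ ≤ 1 := by
    have h4 := Matrix.l2_opNorm_conjTranspose_mul_self V
    rw [h1] at h4
    have h5 := norm_one_matrix_le (m := l)
    nlinarith [norm_nonneg V]
  have h4 : ‖V.conjTranspose‖ ≤ 1 := by rwa [Matrix.l2_opNorm_conjTranspose]
  rw [← h2]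
  calc _ ≤ ‖V.conjTranspose‖ * ‖A‖ * ‖V‖ :=
        (Matrix.l2_opNorm_mul _ _).trans
          (mul_le_mul_of_nonneg_right (Matrix.l2_opNorm_mul _ _) (norm_nonneg _))
    _ ≤ 1 * ‖A‖ * 1 := by gcongr
    _ = ‖A‖ := by ring

theorem norm_partialTraceCompl_le (S : Finset (Fin n)) (A : Operator (Fin n) d) :
    ‖partialTraceCompl S A‖ ≤ Fintype.card (Config {i // i ∉ S} d) * ‖A‖ := by
  have h1 : partialTraceCompl S A = ∑ c : Config {i // i ∉ S} d,
      A.submatrix (fun a => (split d S).symm (a, c)) (fun a => (split d S).symm (a, c)) := by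
    ext a b
    simp [partialTraceCompl, Matrix.sum_apply]
  rw [h1]
  refine (norm_sum_le_of_le _ fun c _ => norm_submatrix_le A ?_).trans_eq (by simp)
  intro a b h
  simpa using h

theorem norm_truncation_le (S : Finset (Fin n)) (A : Operator (Fin n) d) :
    ‖truncation S A‖ ≤ ‖A‖ := by
  rw [truncation, norm_smul, Matrix.trace_one, norm_inv, Complex.norm_natCast]
  set N := Fintype.card (Config {i // i ∉ S} d)
  calc _ ≤ (N : ℝ)⁻¹ * (N * ‖A‖) := by
        gcongr
        exact (norm_tensorOne_le _ _).trans (norm_partialTraceCompl_le S A)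
    _ ≤ ‖A‖ := by
        rw [← mul_assoc]
        exact mul_le_of_le_one_left (norm_nonneg _) inv_mul_le_one

/-- The truncation to `S` as a continuous linear map. -/
noncomputable def truncationCLM (S : Finset (Fin n)) :
    Operator (Fin n) d →L[ℂ] Operator (Fin n) d :=
  LinearMap.mkContinuous
    { toFun := truncation S
      map_add' := fun A B => by
        have : partialTraceCompl S (A + B) = partialTraceCompl S A + partialTraceCompl S B := by
          ext a b; simp [partialTraceCompl, Finset.sum_add_distrib]
        rw [truncation, this]
        exact (congrArg _ (map_add (tensorOneHom S) _ _)).trans (smul_add _ _ _)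
      map_smul' := fun c A => by
        have : partialTraceCompl S (c • A) = c • partialTraceCompl S A := by
          ext a b; simp [partialTraceCompl, Finset.mul_sum]
        rw [truncation, this]
        exact (congrArg _ (map_smul (tensorOneHom S) _ _)).trans (smul_comm _ _ _) }
    1 fun A => by simpa using norm_truncation_le S A

theorem SupportedOn.truncation_eq (hd : 0 < d) {S : Finset (Fin n)} {A : Operator (Fin n) d}
    (hA : SupportedOn S A) : truncation S A = A := by
  obtain ⟨B, rfl⟩ := hA
  have h1 : partialTraceCompl S (tensorOne S B) =
      (Fintype.card (Config {i // i ∉ S} d) : ℂ) • B := by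
    ext a b
    simp [partialTraceCompl, tensorOne]
  have h2 : (Fintype.card (Config {i // i ∉ S} d) : ℂ) ≠ 0 := by
    simp [hd.ne']
  have h3 : ∀ c : ℂ, tensorOne S (c • B) = c • tensorOne S B :=
    fun c => map_smul (tensorOneHom S) c B
  rw [truncation, Matrix.trace_one, h1, h3, smul_smul, inv_mul_cancel₀ h2, one_smul]

/-! ### Calculus of supports -/

/-- Entrywise characterization of the operators supported on `S`. -/
theorem supportedOn_iff (hd : 0 < d) {S : Finset (Fin n)} {A : Operator (Fin n) d} :
    SupportedOn S A ↔
      (∀ x y, A x y ≠ 0 → ∀ i ∉ S, x i = y i) ∧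
      ∀ x y x' y', (∀ i ∈ S, x i = x' i) → (∀ i ∈ S, y i = y' i) → (∀ i ∉ S, x i = y i) →
        (∀ i ∉ S, x' i = y' i) → A x y = A x' y' := by
  constructor
  · rintro ⟨B, rfl⟩
    refine ⟨fun x y h => ?_, fun x y x' y' hx hy h h' => ?_⟩
    · rw [tensorOne_apply] at h
      by_contra h1
      exact h (if_neg h1)
    · rw [tensorOne_apply, tensorOne_apply, if_pos h, if_pos h']
      congr 1 <;> funext i
      exacts [hx i i.2, hy i i.2]
  · rintro ⟨h1, h2⟩
    let ext₀ : Config {i // i ∈ S} d → Config (Fin n) d :=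
      fun a i => if hi : i ∈ S then a ⟨i, hi⟩ else ⟨0, hd⟩
    refine ⟨Matrix.of fun a b => A (ext₀ a) (ext₀ b), ?_⟩
    ext x y
    rw [tensorOne_apply]
    split_ifs with h
    · refine h2 x y _ _ (fun i hi => ?_) (fun i hi => ?_) h (fun i hi => ?_) <;>
        simp [ext₀, hi]
    · by_contra h3
      exact h (h1 x y h3)

theorem SupportedOn.mono (hd : 0 < d) {S T : Finset (Fin n)} (hST : S ⊆ T)
    {A : Operator (Fin n) d} (hA : SupportedOn S A) : SupportedOn T A := by
  rw [supportedOn_iff hd] at hA ⊢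
  obtain ⟨h1, h2⟩ := hA
  refine ⟨fun x y h i hi => h1 x y h i fun h' => hi (hST h'), fun x y x' y' hx hy h h' => ?_⟩
  by_cases hxy : ∀ i ∉ S, x i = y i
  · refine h2 x y x' y' (fun i hi => hx i (hST hi)) (fun i hi => hy i (hST hi)) hxy fun i hi => ?_
    by_cases hT : i ∈ T
    · rw [← hx i hT, ← hy i hT, hxy i hi]
    · exact h' i hT
  -- If `x` and `y` differ somewhere off `S`, so do `x'` and `y'`, and both entries vanish.
  · have hxy' : ¬ ∀ i ∉ S, x' i = y' i := fun h3 => hxy fun i hi => by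
      by_cases hT : i ∈ T
      · rw [hx i hT, hy i hT, h3 i hi]
      · exact h i hT
    rw [not_imp_comm.1 (h1 x y) hxy, not_imp_comm.1 (h1 x' y') hxy']

theorem SupportedOn.mul {S : Finset (Fin n)} {A B : Operator (Fin n) d}
    (hA : SupportedOn S A) (hB : SupportedOn S B) : SupportedOn S (A * B) := by
  obtain ⟨A', rfl⟩ := hA
  obtain ⟨B', rfl⟩ := hB
  exact ⟨A' * B', (map_mul (tensorOneHom S) A' B').symm⟩

theorem SupportedOn.sub {S : Finset (Fin n)} {A B : Operator (Fin n) d}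
    (hA : SupportedOn S A) (hB : SupportedOn S B) : SupportedOn S (A - B) := by
  obtain ⟨A', rfl⟩ := hA
  obtain ⟨B', rfl⟩ := hB
  exact ⟨A' - B', (map_sub (tensorOneHom S) A' B').symm⟩

theorem SupportedOn.zero (S : Finset (Fin n)) : SupportedOn S (0 : Operator (Fin n) d) :=
  ⟨0, (map_zero (tensorOneHom S)).symm⟩

theorem SupportedOn.sum {ι : Type*} {S : Finset (Fin n)} {s : Finset ι}
    {A : ι → Operator (Fin n) d} (hA : ∀ j ∈ s, SupportedOn S (A j)) :
    SupportedOn S (∑ j ∈ s, A j) := by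
  refine Finset.sum_induction A (SupportedOn S) ?_ (SupportedOn.zero S) hA
  rintro _ _ ⟨A', rfl⟩ ⟨B', rfl⟩
  exact ⟨A' + B', (map_add (tensorOneHom S) A' B').symm⟩

/-- Operators supported on disjoint regions commute. -/
theorem SupportedOn.commute (hd : 0 < d) {S T : Finset (Fin n)} (hST : Disjoint S T)
    {A B : Operator (Fin n) d} (hA : SupportedOn S A) (hB : SupportedOn T B) : Commute A B := by
  rw [supportedOn_iff hd] at hA hB
  obtain ⟨hA1, hA2⟩ := hA
  obtain ⟨hB1, hB2⟩ := hB
  have hT : ∀ i ∈ S, i ∉ T := fun i hi => Finset.disjoint_left.1 hST hi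
  have hS : ∀ i ∈ T, i ∉ S := fun i hi => Finset.disjoint_right.1 hST hi
  ext x y
  rw [Matrix.mul_apply, Matrix.mul_apply]
  -- `A` changes only sites of `S` and `B` none of them, so each product has a single possible
  -- intermediate configuration.
  rw [Finset.sum_eq_single (S.piecewise y x : Config (Fin n) d),
    Finset.sum_eq_single (S.piecewise x y : Config (Fin n) d)]
  · by_cases h : ∀ i, i ∉ S → i ∉ T → x i = y i
    · rw [mul_comm]
      congr 1
      · apply hB2 <;> intro i hi
        · simp [hS i hi]
        · simp [hS i hi]
        · by_cases hi' : i ∈ S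
          · simp [hi']
          · simp [hi', h i hi' hi]
        · by_cases hi' : i ∈ S
          · simp [hi']
          · simp [hi', h i hi' hi]
      · apply hA2 <;> intro i hi <;> simp [hi]
    · push Not at h
      obtain ⟨i, h1, h2, h3⟩ := h
      have e1 : B (S.piecewise y x) y = 0 := not_imp_comm.1 (hB1 _ _) fun h4 => h3 <| by
        simpa [h1] using h4 i h2
      have e2 : B x (S.piecewise x y) = 0 := not_imp_comm.1 (hB1 _ _) fun h4 => h3 <| by
        simpa [h1] using h4 i h2
      rw [e1, e2, mul_zero, zero_mul]
  · intro z _ hz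
    by_contra h0
    refine hz (funext fun i => ?_)
    by_cases hi : i ∈ S
    · simp [hi, hB1 x z (left_ne_zero_of_mul h0) i (hT i hi)]
    · simp [hi, hA1 z y (right_ne_zero_of_mul h0) i hi]
  · simp
  · intro z _ hz
    by_contra h0
    refine hz (funext fun i => ?_)
    by_cases hi : i ∈ S
    · simp [hi, hB1 z y (right_ne_zero_of_mul h0) i (hT i hi)]
    · simp [hi, hA1 x z (left_ne_zero_of_mul h0) i hi]
  · simp

/-! ### Nested commutator expansion -/

section Adjoint

variable {𝔸 : Type*} [NormedRing 𝔸] [NormedAlgebra ℂ 𝔸]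

/-- The commutator with `H` as a continuous linear map. -/
noncomputable def adCLM (H : 𝔸) : 𝔸 →L[ℂ] 𝔸 :=
  ContinuousLinearMap.mul ℂ 𝔸 H - (ContinuousLinearMap.mul ℂ 𝔸).flip H

theorem adCLM_apply (H X : 𝔸) : adCLM H X = H * X - X * H := rfl

theorem adCLM_sum {ι : Type*} (s : Finset ι) (h : ι → 𝔸) (X : 𝔸) :
    adCLM (∑ j ∈ s, h j) X = ∑ j ∈ s, adCLM (h j) X := by
  simp only [adCLM_apply, Finset.sum_mul, Finset.mul_sum, Finset.sum_sub_distrib]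

theorem norm_adCLM_apply_le (H X : 𝔸) : ‖adCLM H X‖ ≤ 2 * ‖H‖ * ‖X‖ := by
  calc ‖adCLM H X‖ ≤ ‖H * X‖ + ‖X * H‖ := norm_sub_le _ _
    _ ≤ ‖H‖ * ‖X‖ + ‖X‖ * ‖H‖ := add_le_add (norm_mul_le _ _) (norm_mul_le _ _)
    _ = _ := by ring

/-- The expansion of `e^{τ H} X e^{-τ H}` into nested commutators. -/
theorem hasSum_exp_mul_mul_exp_neg [CompleteSpace 𝔸] (H X : 𝔸) (τ : ℂ) :
    HasSum (fun s : ℕ => ((s.factorial : ℂ)⁻¹ * τ ^ s) • (adCLM H ^ s) X)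
      (NormedSpace.exp (τ • H) * X * NormedSpace.exp (-(τ • H))) := by
  let _ : NormedAlgebra ℚ 𝔸 := NormedAlgebra.restrictScalars ℚ ℂ 𝔸
  let _ : NormedAlgebra ℚ (𝔸 →L[ℂ] 𝔸) := NormedAlgebra.restrictScalars ℚ ℂ (𝔸 →L[ℂ] 𝔸)
  set l : 𝔸 →L[ℂ] 𝔸 := ContinuousLinearMap.mul ℂ 𝔸 (τ • H) with hl
  set r : 𝔸 →L[ℂ] 𝔸 := (ContinuousLinearMap.mul ℂ 𝔸).flip (-(τ • H)) with hr
  have hl' (Y : 𝔸) : NormedSpace.exp l Y = NormedSpace.exp (τ • H) * Y := by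
    have h1 := (NormedSpace.exp_series_hasSum_exp' (𝕂 := ℂ) l).mapL
      (ContinuousLinearMap.apply ℂ 𝔸 Y)
    have h2 := (NormedSpace.exp_series_hasSum_exp' (𝕂 := ℂ) (τ • H)).mul_right Y
    refine h1.unique (h2.congr_fun fun s => ?_)
    have : ∀ s : ℕ, (l ^ s) Y = (τ • H) ^ s * Y := fun s => by
      induction s with
      | zero => simp
      | succ s ih => rw [pow_succ', mul_apply_eq_comp, ih, pow_succ', mul_assoc]; rfl
    simp [this]
  have hr' (Y : 𝔸) : NormedSpace.exp r Y = Y * NormedSpace.exp (-(τ • H)) := by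
    have h1 := (NormedSpace.exp_series_hasSum_exp' (𝕂 := ℂ) r).mapL
      (ContinuousLinearMap.apply ℂ 𝔸 Y)
    have h2 := (NormedSpace.exp_series_hasSum_exp' (𝕂 := ℂ) (-(τ • H))).mul_left Y
    refine h1.unique (h2.congr_fun fun s => ?_)
    have : ∀ s : ℕ, (r ^ s) Y = Y * (-(τ • H)) ^ s := fun s => by
      induction s with
      | zero => simp
      | succ s ih => rw [pow_succ', mul_apply_eq_comp, ih, pow_succ, ← mul_assoc]; rfl
    simp [this]
  -- Left and right multiplications commute by associativity, so the exponential of their sum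
  -- factors.
  have hlr : Commute l r := by
    ext Y
    exact (mul_assoc _ _ _).symm
  have hsum : l + r = τ • adCLM H := by
    ext Y
    simp [hl, hr, adCLM_apply, sub_eq_add_neg]
  have h1 := (NormedSpace.exp_series_hasSum_exp' (𝕂 := ℂ) (τ • adCLM H)).mapL
    (ContinuousLinearMap.apply ℂ 𝔸 X)
  have h2 : NormedSpace.exp (τ • adCLM H) X =
      NormedSpace.exp (τ • H) * X * NormedSpace.exp (-(τ • H)) := by
    rw [← hsum, NormedSpace.exp_add_of_commute hlr, mul_apply_eq_comp, hr', hl',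
      mul_assoc]
  have h3 (s : ℕ) : ((τ • adCLM H) ^ s) X = τ ^ s • (adCLM H ^ s) X := by
    induction s with
    | zero => simp
    | succ s ih =>
      rw [pow_succ', mul_apply_eq_comp, ih, map_smul, pow_succ' (adCLM H), mul_apply_eq_comp,
        smul_apply, smul_smul, pow_succ]
  rw [← h2]
  refine h1.congr_fun fun s => ?_
  rw [ContinuousLinearMap.apply_apply, smul_apply, h3, smul_smul]

end Adjoint

/-! ### Growth of supports and norms of nested commutators -/

/-- The sites of the chain lying in the integer interval `[a, b)`. -/
def region (n : ℕ) (a b : ℤ) : Finset (Fin n) :=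
  Finset.univ.filter fun i : Fin n => a ≤ (i.val : ℤ) ∧ (i.val : ℤ) < b

theorem mem_region {a b : ℤ} {i : Fin n} :
    i ∈ region n a b ↔ a ≤ (i.val : ℤ) ∧ (i.val : ℤ) < b := by
  simp [region]

theorem card_region_le (a b : ℤ) : (region n a b).card ≤ (b - a).toNat := by
  rw [← Int.card_Ico]
  refine Finset.card_le_card_of_injOn (fun i : Fin n => (i.val : ℤ)) (fun i hi => ?_) ?_
  · simpa [mem_region] using hi
  · intro i _ j _ h
    simpa [Fin.ext_iff] using h

theorem card_region_le_of_sub_le {a b : ℤ} {c : ℝ} (hc : 0 ≤ c) (h : ((b - a : ℤ) : ℝ) ≤ c) :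
    ((region n a b).card : ℝ) ≤ c := by
  have h1 : ((region n a b).card : ℝ) ≤ ((b - a).toNat : ℝ) := by exact_mod_cast card_region_le a b
  refine h1.trans ?_
  have h2 : (((b - a).toNat : ℤ) : ℝ) = ((max (b - a) 0 : ℤ) : ℝ) := by rw [Int.toNat_eq_max]
  rw [Int.cast_natCast] at h2
  rw [h2, Int.cast_max]
  exact max_le h (by simpa using hc)

variable {k : ℕ} {h : Fin n → Operator (Fin n) d}

theorem IsLocalHamiltonian.supportedOn_region (hh : IsLocalHamiltonian k h) (j : Fin n) :
    SupportedOn (region n j.val (j.val + k)) (h j) := by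
  convert hh.supportedOn j using 1
  ext i
  simp only [mem_region, Finset.mem_filter, Finset.mem_univ, true_and]
  omega

theorem IsLocalHamiltonian.norm_adCLM_le (hh : IsLocalHamiltonian k h) (j : Fin n)
    (X : Operator (Fin n) d) : ‖adCLM (h j) X‖ ≤ 2 * ‖X‖ := by
  refine (norm_adCLM_apply_le _ _).trans ?_
  have := hh.norm_le_one j
  nlinarith [norm_nonneg X]

theorem SupportedOn.adCLM {S : Finset (Fin n)} {A B : Operator (Fin n) d}
    (hA : SupportedOn S A) (hB : SupportedOn S B) : SupportedOn S (adCLM A B) :=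
  (hA.mul hB).sub (hB.mul hA)

theorem adCLM_eq_zero_of_disjoint (hd : 0 < d) {S T : Finset (Fin n)} (hST : Disjoint S T)
    {A B : Operator (Fin n) d} (hA : SupportedOn S A) (hB : SupportedOn T B) :
    adCLM A B = 0 :=
  sub_eq_zero.2 (hA.commute hd hST hB)

/-- Terms disjoint from the region commute with `X`; one meeting it reaches at most `k - 1` sites
further. -/
theorem IsLocalHamiltonian.supportedOn_enlarge_adCLM (hd : 0 < d) (hh : IsLocalHamiltonian k h)
    {L : Finset (Fin n)} {q : ℕ} {X : Operator (Fin n) d} (hX : SupportedOn (enlarge L q) X) :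
    SupportedOn (enlarge L (q + (k - 1))) (adCLM (∑ j, h j) X) := by
  rw [adCLM_sum]
  refine SupportedOn.sum fun j _ => ?_
  by_cases hdisj : Disjoint (region n j.val (j.val + k)) (enlarge L q)
  · rw [adCLM_eq_zero_of_disjoint hd hdisj (hh.supportedOn_region j) hX]
    exact SupportedOn.zero _
  · obtain ⟨i, hi, hi'⟩ := Finset.not_disjoint_iff.1 hdisj
    rw [mem_region] at hi
    simp only [enlarge, Finset.mem_filter, Finset.mem_univ, true_and] at hi'
    obtain ⟨p, hp, hpi⟩ := hi'
    refine SupportedOn.adCLM ((hh.supportedOn_region j).mono hd ?_) (hX.mono hd ?_) <;> intro i' hi''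
    · rw [mem_region] at hi''
      simp only [enlarge, Finset.mem_filter, Finset.mem_univ, true_and]
      refine ⟨p, hp, ?_⟩
      unfold Nat.dist at *
      omega
    · simp only [enlarge, Finset.mem_filter, Finset.mem_univ, true_and] at hi'' ⊢
      obtain ⟨p', hp', h'⟩ := hi''
      exact ⟨p', hp', by omega⟩

theorem IsLocalHamiltonian.supportedOn_enlarge_adCLM_pow (hd : 0 < d)
    (hh : IsLocalHamiltonian k h) {L : Finset (Fin n)} {X : Operator (Fin n) d}
    (hX : SupportedOn L X) (s : ℕ) :
    SupportedOn (enlarge L (s * (k - 1))) ((adCLM (∑ j, h j) ^ s) X) := by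
  induction s with
  | zero =>
    refine SupportedOn.mono hd (fun i hi => ?_) hX
    simp only [enlarge, Finset.mem_filter, Finset.mem_univ, true_and]
    exact ⟨i, hi, by simp⟩
  | succ s ih =>
    rw [pow_succ', mul_apply_eq_comp, add_one_mul]
    exact hh.supportedOn_enlarge_adCLM hd ih

/-- The norm of nested commutators with a local Hamiltonian of an operator supported on an
interval. -/
theorem IsLocalHamiltonian.norm_adCLM_pow_le (hd : 0 < d) (hk : 0 < k)
    (hh : IsLocalHamiltonian k h) (s : ℕ) (a : ℤ) (r : ℕ) {X : Operator (Fin n) d}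
    (hX : SupportedOn (region n a (a + k + r * (k - 1))) X) :
    ‖(adCLM (∑ j, h j) ^ s) X‖ ≤ (2 * k) ^ s * growthCount s r * ‖X‖ := by
  induction s generalizing a r X with
  | zero => simp [growthCount]
  | succ s ih =>
    have hk1 : (1 : ℤ) ≤ k := by exact_mod_cast hk
    have hk1' : (1 : ℝ) ≤ k := by exact_mod_cast hk
    obtain ⟨p, hp⟩ : ∃ p : ℤ, p = r * (k - 1) := ⟨_, rfl⟩
    have hp0 : 0 ≤ p := hp ▸ mul_nonneg (by positivity) (by omega)
    have hp' : ((r + 1 : ℕ) : ℤ) * (k - 1) = p + (k - 1) := by rw [hp]; push_cast; ring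
    have hpR : (p : ℝ) ≤ r * (k - 1) := by rw [hp]; push_cast; rfl
    set c₀ : ℝ := (2 * k) ^ s * growthCount s r * (2 * ‖X‖) with hc₀
    set c₁ : ℝ := (2 * k) ^ s * growthCount s (r + 1) * (2 * ‖X‖) with hc₁
    have hc₀' : 0 ≤ c₀ := by positivity
    have hc₁' : 0 ≤ c₁ := by positivity
    rw [← hp] at hX
    -- By position of `j`: term inside the interval, crossing its left end, or crossing its right
    -- end; all others commute with `X`.
    have key (j : Fin n) : ‖(SpinChain.adCLM (∑ j, h j) ^ s) (SpinChain.adCLM (h j) X)‖ ≤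
        (if j ∈ region n a (a + p + 1) then c₀ else 0) +
        (if j ∈ region n (a - k + 1) a then c₁ else 0) +
        (if j ∈ region n (a + p + 1) (a + k + p) then c₁ else 0) := by
      simp only [mem_region]
      have hX' := hh.norm_adCLM_le j X
      have bound₁ (a' : ℤ) (h1 : SupportedOn (region n a' (a' + k + (p + (k - 1))))
          (SpinChain.adCLM (h j) X)) :
          ‖(SpinChain.adCLM (∑ j, h j) ^ s) (SpinChain.adCLM (h j) X)‖ ≤ c₁ := by
        rw [← hp'] at h1
        refine (ih a' (r + 1) h1).trans ?_
        rw [hc₁]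
        gcongr
      have nested {a' b' : ℤ} (h1 : a' ≤ a) (h2 : a' ≤ j.val) (h3 : a + k + p ≤ b')
          (h4 : j.val + k ≤ b') : SupportedOn (region n a' b') (SpinChain.adCLM (h j) X) := by
        refine SupportedOn.adCLM ((hh.supportedOn_region j).mono hd ?_) (hX.mono hd ?_) <;>
          intro i hi <;> rw [mem_region] at hi ⊢ <;> omega
      rcases lt_or_ge (j.val : ℤ) (a - k + 1) with h1 | h1
      · rw [adCLM_eq_zero_of_disjoint hd _ (hh.supportedOn_region j) hX, map_zero, norm_zero]
        · positivity
        · refine Finset.disjoint_left.2 fun i hi hi' => ?_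
          rw [mem_region] at hi hi'
          omega
      rcases lt_or_ge (j.val : ℤ) a with h2 | h2
      · rw [if_neg (by omega), if_pos (by omega), if_neg (by omega), zero_add, add_zero]
        exact bound₁ (a - (k - 1)) (nested (by omega) (by omega) (by omega) (by omega))
      rcases lt_or_ge (j.val : ℤ) (a + p + 1) with h3 | h3
      · rw [if_pos (by omega), if_neg (by omega), if_neg (by omega), add_zero, add_zero]
        have h4 := nested (a' := a) (b' := a + k + p) (by omega) (by omega) (by omega) (by omega)
        rw [hp] at h4
        refine (ih a r h4).trans ?_
        rw [hc₀]
        gcongr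
      rcases lt_or_ge (j.val : ℤ) (a + k + p) with h4 | h4
      · rw [if_neg (by omega), if_neg (by omega), if_pos (by omega), zero_add, zero_add]
        exact bound₁ a (nested (by omega) (by omega) (by omega) (by omega))
      · rw [adCLM_eq_zero_of_disjoint hd _ (hh.supportedOn_region j) hX, map_zero, norm_zero]
        · positivity
        · refine Finset.disjoint_left.2 fun i hi hi' => ?_
          rw [mem_region] at hi hi'
          omega
    -- Only the innermost commutator is split into local terms; induction handles the outer ones.
    rw [pow_succ, mul_apply_eq_comp, adCLM_sum, map_sum]
    refine (norm_sum_le_of_le _ fun j _ => key j).trans ?_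
    simp only [Finset.sum_add_distrib, Finset.sum_ite_mem, Finset.univ_inter, Finset.sum_const,
      nsmul_eq_mul]
    have b0 : ((region n a (a + p + 1)).card : ℝ) ≤ k * (r + 1) := by
      refine card_region_le_of_sub_le (by positivity) ?_
      push_cast
      nlinarith
    have b1 : ((region n (a - k + 1) a).card : ℝ) ≤ k := by
      refine card_region_le_of_sub_le (by positivity) ?_
      push_cast
      linarith
    have b2 : ((region n (a + p + 1) (a + k + p)).card : ℝ) ≤ k := by
      refine card_region_le_of_sub_le (by positivity) ?_
      push_cast
      linarith
    calc _ ≤ k * (r + 1) * c₀ + k * c₁ + k * c₁ := by gcongr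
      _ = _ := by
        rw [hc₀, hc₁]
        simp only [growthCount]
        push_cast
        ring

theorem exists_subset_region {L : Finset (Fin n)} (hL : (L : Set (Fin n)).OrdConnected)
    (hLk : L.card ≤ k) : ∃ a : ℤ, L ⊆ region n a (a + k) := by
  rcases L.eq_empty_or_nonempty with rfl | hne
  · exact ⟨0, by simp⟩
  · refine ⟨(L.min' hne).val, fun i hi => ?_⟩
    have h1 : L.min' hne ≤ i := L.min'_le i hi
    have h2 : Finset.Icc (L.min' hne) i ⊆ L := fun x hx =>
      hL.out (L.min'_mem hne) hi (Finset.mem_Icc.1 hx)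
    have h3 := (Finset.card_le_card h2).trans hLk
    rw [Fin.card_Icc] at h3
    have h4 : (L.min' hne).val ≤ i.val := h1
    rw [mem_region]
    omega

/-- The norm of the `s`-th term in the nested commutator expansion. -/
theorem IsLocalHamiltonian.two_mul_norm_term_le (hd : 0 < d) (hk : 0 < k)
    (hh : IsLocalHamiltonian k h) {L : Finset (Fin n)} (hL : (L : Set (Fin n)).OrdConnected)
    (hLk : L.card ≤ k) {O : Operator (Fin n) d} (hO : SupportedOn L O) {γ : ℝ} (hγ₀ : 0 < γ)
    (hγ : γ ≤ 1.6027) {τ : ℝ} (hτ : 0 ≤ τ) {m s : ℕ} (hm : 2 ≤ m) (hms : m ≤ s) :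
    2 * ‖((s.factorial : ℂ)⁻¹ * (τ : ℂ) ^ s) • (adCLM (∑ j, h j) ^ s) O‖ ≤
      ‖O‖ * (6 * Real.exp 1 * k * τ / (γ * Real.log m)) ^ s := by
  obtain ⟨a, ha⟩ := exists_subset_region hL hLk
  have h1 := hh.norm_adCLM_pow_le hd hk s a 0 (hO.mono hd (by simpa using ha))
  have h2 := two_mul_growthCount_div_factorial_le hγ₀ hγ (hm.trans hms)
  have hlog : 0 < Real.log m := Real.log_pos (by exact_mod_cast hm)
  have hlog' : Real.log m ≤ Real.log s :=
    Real.log_le_log (by exact_mod_cast (by omega : 0 < m)) (by exact_mod_cast hms)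
  rw [norm_smul, norm_mul, norm_inv, Complex.norm_natCast, norm_pow, Complex.norm_real,
    Real.norm_of_nonneg hτ]
  calc _ ≤ 2 * ((s.factorial : ℝ)⁻¹ * τ ^ s * ((2 * k) ^ s * growthCount s 0 * ‖O‖)) := by gcongr
    _ = ‖O‖ * ((2 * k * τ) ^ s * (2 * (growthCount s 0 / s.factorial))) := by
      rw [mul_pow]; ring
    _ ≤ ‖O‖ * ((2 * k * τ) ^ s * (3 * Real.exp 1 / (γ * Real.log s)) ^ s) := by gcongr
    _ ≤ ‖O‖ * ((2 * k * τ) ^ s * (3 * Real.exp 1 / (γ * Real.log m)) ^ s) := by gcongr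
    _ = _ := by rw [← mul_pow]; congr 2; ring

end SpinChain

/-! ### Summing the tail -/

theorem lemma1 (n d k : ℕ) (hd : 0 < d) (hk : 0 < k)
    (h : Fin n → SpinChain.Operator (Fin n) d) (hh : SpinChain.IsLocalHamiltonian k h)
    (L : Finset (Fin n)) (hL : (L : Set (Fin n)).OrdConnected) (hLk : L.card ≤ k)
    (O : SpinChain.Operator (Fin n) d) (hO : SpinChain.SupportedOn L O)
    (γ : ℝ) (hγ : |γ - 1.6026| ≤ 0.0001)
    (τ : ℝ) (hτ : 0 ≤ τ) (l : ℕ) (hl : k < l) (hζ : SpinChain.zeta γ k l τ < 1) :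
    ‖SpinChain.imaginaryEvolution (∑ j, h j) τ O -
        SpinChain.truncation (SpinChain.enlarge L l)
          (SpinChain.imaginaryEvolution (∑ j, h j) τ O)‖ ≤
      ‖O‖ * (SpinChain.zeta γ k l τ ^ ⌈(l : ℝ) / k⌉₊ / (1 - SpinChain.zeta γ k l τ)) := by
  have hγ' := abs_le.1 hγ
  have hγ₀ : 0 < γ := by linarith [hγ'.1]
  have hγ₁ : γ ≤ 1.6027 := by linarith [hγ'.2]
  have hkR : (0 : ℝ) < k := by exact_mod_cast hk
  set m := ⌈(l : ℝ) / k⌉₊ with hm_def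
  have hm : 2 ≤ m := by
    refine Nat.lt_ceil.2 ?_
    rw [lt_div_iff₀ hkR]
    simpa using hl
  set ζ := SpinChain.zeta γ k l τ with hζ_def
  have hζ₀ : 0 ≤ ζ := by
    have := Real.log_natCast_nonneg m
    rw [hζ_def, SpinChain.zeta]
    positivity
  set H := ∑ j, h j
  let D := ContinuousLinearMap.id ℂ (SpinChain.Operator (Fin n) d) -
    SpinChain.truncationCLM (SpinChain.enlarge L l)
  have hD (X : SpinChain.Operator (Fin n) d) :
      D X = X - SpinChain.truncation (SpinChain.enlarge L l) X := rfl
  have hDle (X : SpinChain.Operator (Fin n) d) : ‖D X‖ ≤ 2 * ‖X‖ := by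
    rw [hD, two_mul]
    exact (norm_sub_le _ _).trans (add_le_add_right (SpinChain.norm_truncation_le _ X) _)
  have hsum := (SpinChain.hasSum_exp_mul_mul_exp_neg H O (τ : ℂ)).mapL D
  have hzero : ∑ s ∈ Finset.range m,
      D (((s.factorial : ℂ)⁻¹ * (τ : ℂ) ^ s) • (SpinChain.adCLM H ^ s) O) = 0 := by
    refine Finset.sum_eq_zero fun s hs => ?_
    -- `s < ⌈l/k⌉` means `s * k < l`, so the term has not yet left the enlarged region.
    have h1 := Nat.lt_ceil.1 (Finset.mem_range.1 hs)
    rw [lt_div_iff₀ hkR] at h1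
    have h2 : s * k < l := by exact_mod_cast h1
    have h3 : s * (k - 1) ≤ l := (Nat.mul_le_mul_left s (Nat.sub_le k 1)).trans h2.le
    have h4 := (hh.supportedOn_enlarge_adCLM_pow hd hO s).mono (T := SpinChain.enlarge L l) hd
      fun i hi => by
        simp only [SpinChain.enlarge, Finset.mem_filter, Finset.mem_univ, true_and] at hi ⊢
        obtain ⟨j, hj, hij⟩ := hi
        exact ⟨j, hj, hij.trans h3⟩
    rw [map_smul, hD, h4.truncation_eq hd, sub_self, smul_zero]
  have htail := (hasSum_nat_add_iff' m).2 hsum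
  rw [hzero, sub_zero, hD] at htail
  have hgeom := ((hasSum_geometric_of_lt_one hζ₀ hζ).mul_left (‖O‖ * ζ ^ m))
  rw [div_eq_mul_inv, ← mul_assoc]
  refine htail.norm_le_of_bounded hgeom fun s => (hDle _).trans ?_
  rw [mul_assoc, ← pow_add, add_comm m s]
  exact hh.two_mul_norm_term_le hd hk hL hLk hO hγ₀ hγ₁ hτ hm (Nat.le_add_left m s)
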